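/- Finite sequences are ordered by the initial segment ordering $\leqslant$, $\smallfrown$ denotes concatenation, and $MAX(T)$ is the set of maximal members of a set $T$ of sequences. For an ordinal $\eta$ and a sequence $t=(\zeta_i)_{i}$ of ordinals, $\eta+t=(\eta+\zeta_i)_{i}$. For each ordinal $\xi$ and $n\in\mathbb{N}=\{1,2,\ldots\}$, define trees $\Gamma_{\xi,n}$ of non-empty finite sequences of ordinals and functions $\mathbb{P}_{\xi,n}:\Gamma_{\xi,n}\to[0,1]$ recursively by * $\Gamma_{0,1}=\{(0)\}$, $\mathbb{P}_{0,1}((0))=1$; * $\Gamma_{\xi,n+1}=\{\omega^\xi n+s: s\in\Gamma_{\xi,1}\}\cup\{(\omega^\xi n+t)\smallfrown u: t\in MAX(\Gamma_{\xi,1}),\,u\in\Gamma_{\xi,n}\}$, with $\mathbb{P}_{\xi,n+1}(\omega^\xi n+s)=\mathbb{P}_{\xi,1}(s)$ and $\mathbb{P}_{\xi,n+1}((\omega^\xi n+t)\smallfrown u)=\mathbb{P}_{\xi,n}(u)$; * $\Gamma_{\xi+1,1}=\bigcup_{n=1}^\infty\Gamma_{\xi,n}$ with $\mathbb{P}_{\xi+1,1}|_{\Gamma_{\xi,n}}=n^{-1}\mathbb{P}_{\xi,n}$;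 * $\Gamma_{\xi,1}=\bigcup_{\zeta<\xi}(\omega^\zeta+\Gamma_{\zeta+1,1})$ with $\mathbb{P}_{\xi,1}(\omega^\zeta+t)=\mathbb{P}_{\zeta+1,1}(t)$, for limit $\xi$. For $1\leqslant i\leqslant n$, the level $\Lambda_{\xi,n,i}$ is the set of all $(\omega^\xi(n-1)+t_1)\smallfrown\cdots\smallfrown(\omega^\xi(n-i)+t_i)$ with $t_1,\ldots,t_{i-1}\in MAX(\Gamma_{\xi,1})$ and $t_i\in\Gamma_{\xi,1}$. Let $X,Y$ be (real or complex) Banach spaces and $A:X\to Y$ a bounded linear operator. Let $D_X$ be the set of weakly open subsets of $X$ containing $0$, directed by reverse inclusion. For a set $T$ of sequences of ordinals, let $T.D_X=\{(\zeta_i,u_i)_{i=1}^k:(\zeta_i)_{i=1}^k\in T,\ u_i\in D_X\}$, and put $\mathbb{P}_{\xi,n}((\zeta_i,u_i)_{i=1}^k)=\mathbb{P}_{\xi,n}((\zeta_i)_{i=1}^k)$. Let $\mathcal{B}^X_{\xi,n}$ be the set of families $(x_t)_{t\in\Gamma_{\xi,n}.D_X}$ in the closed unit ball $B_X$ that are weakly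 null: whenever $t\in\{\varnothing\}\cup\Gamma_{\xi,n}.D_X$ and $\zeta$ are such that $t\smallfrown(\zeta,u)\in\Gamma_{\xi,n}.D_X$ for some (equivalently, every) $u\in D_X$, the net $(x_{t\smallfrown(\zeta,u)})_{u\in D_X}$ is weakly null. For a finitely supported scalar sequence $(a_i)_{i=1}^\infty\in c_{00}$, with $(e_i)_{i=1}^\infty$ the canonical basis of $c_{00}$, put $$\Big\|\sum_i a_ie_i\Big\|_{\xi,A}=\sup_{n\in\mathbb{N}}\ \sup_{(x_t)\in\mathcal{B}^X_{\xi,n}}\ \inf_{t\in MAX(\Gamma_{\xi,n}.D_X)}\Big\|A\sum_{i=1}^n a_i\sum_{\Lambda_{\xi,n,i}.D_X\ni s\leqslant t}\mathbb{P}_{\xi,n}(s)x_s\Big\|.$$ For $1<p\leqslant\infty$ and $1/p+1/q=1$ let $\alpha_{\xi,p}(A)=\sup_n\sup\{\|\sum_{i=1}^na_ie_i\|_{\xi,A}:(a_i)_{i=1}^n\in B_{\ell_p^n}\}$ and $\theta_{\xi,n}(A)=\|n^{-1}\sum_{i=1}^ne_i\|_{\xi,A}$. Let $\mathfrak{A}_{\xi,p}$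 be the class of operators $A$ with $\alpha_{\xi,p}(A)<\infty$, and $\mathfrak{N}_{\xi,p}$ the class of operators $A$ with $\sup_n\theta_{\xi,n}(A)\,n^{1/q}<\infty$. **Proposition.** For every ordinal $\xi$, $\mathfrak{A}_{\xi,\infty}=\mathfrak{N}_{\xi,\infty}$. Moreover, for every operator $A$ between Banach spaces, $\alpha_{\xi,\infty}(A)<\infty$ if and only if $\sup_n\|\sum_{i=1}^n e_i\|_{\xi,A}<\infty$. -/

import Mathlib

open scoped ENNReal Topology

noncomputable section

namespace AsymptoticProperties

/-! ### Trees of finite sequences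

A finite sequence is a `List`, and `s ≤ t` for sequences is the prefix relation `s <+: t`.
The initial segment `t|_k` is `t.take k`. Trees consist of non-empty sequences. -/

/-- `MAX(T)`: the members of `T` that are maximal for the initial segment ordering. -/
def maxElems {α : Type*} (T : Set (List α)) : Set (List α) :=
  {t | t ∈ T ∧ ∀ s ∈ T, t <+: s → s = t}

/-- `ζ + t = (ζ + ζ_i)_i` for a sequence `t = (ζ_i)_i` of ordinals. -/
def shift (ζ : Ordinal) (t : List Ordinal) : List Ordinal :=
  t.map (fun η => ζ + η)

/-- The recursion producing `Γ_{ξ,n}` from `G = Γ_{ξ,1}`: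
`Γ_{ξ,n+1} = {ω^ξ n + s : s ∈ G} ∪ {(ω^ξ n + t) ⌢ u : t ∈ MAX(G), u ∈ Γ_{ξ,n}}`.
With the convention `Γ_{ξ,0} = ∅` this also gives `Γ_{ξ,1} = G`. -/
def stack (ξ : Ordinal) (G : Set (List Ordinal)) : ℕ → Set (List Ordinal)
  | 0 => ∅
  | n + 1 =>
      {t | ∃ s ∈ G, t = shift (Ordinal.omega0 ^ ξ * n) s} ∪
      {t | ∃ v ∈ maxElems G, ∃ u ∈ stack ξ G n, t = shift (Ordinal.omega0 ^ ξ * n) v ++ u}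

/-- The tree `Γ_{ξ,1}`, by transfinite recursion: `Γ_{0,1} = {(0)}`,
`Γ_{ξ+1,1} = ⋃_{n ≥ 1} Γ_{ξ,n}`, and `Γ_{ξ,1} = ⋃_{ζ<ξ} (ω^ζ + Γ_{ζ+1,1})` for limit `ξ`. -/
def gammaOne (ξ : Ordinal) : Set (List Ordinal) :=
  Ordinal.limitRecOn (motive := fun _ => Set (List Ordinal)) ξ
    {[0]}
    (fun ξ G => {t | ∃ n : ℕ, 1 ≤ n ∧ t ∈ stack ξ G n})
    (fun ξ hξ G => {t | ∃ ζ, ∃ hζ : ζ < ξ,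
      ∃ s ∈ G (ζ + 1) (hξ.add_one_lt hζ), t = shift (Ordinal.omega0 ^ ζ) s})

/-- The tree `Γ_{ξ,n}`, for `n ≥ 1`. -/
def gamma (ξ : Ordinal) (n : ℕ) : Set (List Ordinal) :=
  stack ξ (gammaOne ξ) n

/-- The levels `Λ_{ξ,n,i}`, `1 ≤ i ≤ n`, of `Γ_{ξ,n}`: the sequences
`(ω^ξ (n-1) + t_1) ⌢ (ω^ξ (n-2) + t_2) ⌢ … ⌢ (ω^ξ (n-i) + t_i)` with
`t_1, …, t_{i-1} ∈ MAX(Γ_{ξ,1})` and `t_i ∈ Γ_{ξ,1}`. -/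
def level (ξ : Ordinal) : ℕ → ℕ → Set (List Ordinal)
  | 0, _ => ∅
  | _ + 1, 0 => ∅
  | n + 1, 1 => {t | ∃ s ∈ gammaOne ξ, t = shift (Ordinal.omega0 ^ ξ * n) s}
  | n + 1, i + 2 => {t | ∃ v ∈ maxElems (gammaOne ξ), ∃ u ∈ level ξ n (i + 1),
      t = shift (Ordinal.omega0 ^ ξ * n) v ++ u}

open Classical in
/-- The recursion producing `ℙ_{ξ,n} : Γ_{ξ,n} → [0,1]` from `P = ℙ_{ξ,1}`:
`ℙ_{ξ,n+1}(ω^ξ n + s) = P(s)` for `s ∈ Γ_{ξ,1}`, and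
`ℙ_{ξ,n+1}((ω^ξ n + v) ⌢ u) = ℙ_{ξ,n}(u)` for `v ∈ MAX(Γ_{ξ,1})`, `u ∈ Γ_{ξ,n}`.
The chosen decompositions are unique; the value off `Γ_{ξ,n}` is never used. -/
def probStack (ξ : Ordinal) (P : List Ordinal → ℝ) : ℕ → List Ordinal → ℝ
  | 0, _ => 0
  | n + 1, t =>
      if h : ∃ s, s ∈ gammaOne ξ ∧ t = shift (Ordinal.omega0 ^ ξ * n) s then P h.choose
      else if h : ∃ u, u ∈ gamma ξ n ∧
          ∃ v ∈ maxElems (gammaOne ξ), t = shift (Ordinal.omega0 ^ ξ * n) v ++ u then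
        probStack ξ P n h.choose
      else 0

open Classical in
/-- The function `ℙ_{ξ,1}` on `Γ_{ξ,1}`: `ℙ_{0,1}((0)) = 1`, `ℙ_{ξ+1,1} = n⁻¹ ℙ_{ξ,n}` on
`Γ_{ξ,n}`, and `ℙ_{ξ,1}(ω^ζ + s) = ℙ_{ζ+1,1}(s)` for limit `ξ`, `ζ < ξ`, `s ∈ Γ_{ζ+1,1}`.
The unions defining `Γ_{ξ,1}` are disjoint, so the chosen indices are unique. -/
def probOne (ξ : Ordinal) : List Ordinal → ℝ :=
  Ordinal.limitRecOn (motive := fun _ => List Ordinal → ℝ) ξ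
    (fun _ => 1)
    (fun ξ P t =>
      if h : ∃ n : ℕ, 1 ≤ n ∧ t ∈ gamma ξ n then
        (h.choose : ℝ)⁻¹ * probStack ξ P h.choose t
      else 0)
    (fun ξ hξ P t =>
      if h : ∃ q : Set.Iio ξ × List Ordinal, q.2 ∈ gammaOne (q.1.1 + 1) ∧
          t = shift (Ordinal.omega0 ^ q.1.1) q.2 then
        P (h.choose.1.1 + 1) (hξ.add_one_lt h.choose.1.2) h.choose.2
      else 0)

/-- The function `ℙ_{ξ,n}` on `Γ_{ξ,n}`. -/
def prob (ξ : Ordinal) (n : ℕ) : List Ordinal → ℝ :=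
  probStack ξ (probOne ξ) n

/-- `T.D = {(ζ_i, u_i)_i : (ζ_i)_i ∈ T, u_i ∈ D}`. -/
def treeProd (T : Set (List Ordinal)) (D : Type*) : Set (List (Ordinal × D)) :=
  {t | t.map Prod.fst ∈ T}

/-! ### Weakly null collections -/

variable (𝕜 : Type*) [RCLike 𝕜]

/-- `D_X`: the weakly open sets in `X` that contain `0`, directed by reverse inclusion. -/
abbrev WeakNhds (X : Type*) [NormedAddCommGroup X] [NormedSpace 𝕜 X] : Type _ :=
  (TopologicalSpace.OpenNhdsOf (0 : WeakSpace 𝕜 X))ᵒᵈ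

/-- The collection `(x_t)_{t ∈ T.D}` is weakly null: whenever `t ∈ {∅} ∪ T.D` and `ζ` are such
that `t ⌢ (ζ, u) ∈ T.D` for some `u`, the net `(x_{t ⌢ (ζ, u)})_{u ∈ D}` is weakly null. A
collection is a function on all sequences, of which only the values on `T.D` matter. -/
def IsWeaklyNull {X : Type*} [NormedAddCommGroup X] [NormedSpace 𝕜 X]
    (T : Set (List Ordinal)) {D : Type*} [Preorder D] (x : List (Ordinal × D) → X) : Prop :=
  ∀ t ∈ insert [] (treeProd T D), ∀ ζ : Ordinal, (∃ u : D, t ++ [(ζ, u)] ∈ treeProd T D) →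
    Filter.Tendsto (fun u : D => toWeakSpace 𝕜 X (x (t ++ [(ζ, u)]))) Filter.atTop (𝓝 0)

/-- `ℬ^X_{ξ,n}`: the weakly null collections `(x_t)_{t ∈ Γ_{ξ,n}.D_X} ⊂ B_X`. -/
def nullCollections (X : Type*) [NormedAddCommGroup X] [NormedSpace 𝕜 X]
    (ξ : Ordinal) (n : ℕ) : Set (List (Ordinal × WeakNhds 𝕜 X) → X) :=
  {x | (∀ t ∈ treeProd (gamma ξ n) (WeakNhds 𝕜 X), ‖x t‖ ≤ 1) ∧ IsWeaklyNull 𝕜 (gamma ξ n) x}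

variable {𝕜}
variable {X Y : Type*} [NormedAddCommGroup X] [NormedSpace 𝕜 X]
  [NormedAddCommGroup Y] [NormedSpace 𝕜 Y]

open Classical in
/-- `∑_{Λ_{ξ,n,i}.D ∋ s ≤ t} ℙ_{ξ,n}(s) x_s`. -/
def levelSum (𝕜 : Type*) [RCLike 𝕜] {X : Type*} [NormedAddCommGroup X] [NormedSpace 𝕜 X]
    {D : Type*} (ξ : Ordinal) (n i : ℕ) (x : List (Ordinal × D) → X) (t : List (Ordinal × D)) : X :=
  ∑ k ∈ Finset.Icc 1 t.length with t.take k ∈ treeProd (level ξ n i) D,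
    ((prob ξ n ((t.take k).map Prod.fst) : ℝ) : 𝕜) • x (t.take k)

/-- The seminorm `‖·‖_{ξ,A}` on `c₀₀`. The basis of `c₀₀ = ℕ →₀ 𝕜` is indexed from `0`, so that
the coefficient of level `i + 1` is `a i`. The value is taken in `[0,∞]`. -/
def treeNorm (ξ : Ordinal) (A : X →L[𝕜] Y) (a : ℕ →₀ 𝕜) : ℝ≥0∞ :=
  ⨆ (n : ℕ) (_ : 1 ≤ n) (x ∈ nullCollections 𝕜 X ξ n),
    ⨅ t ∈ maxElems (treeProd (gamma ξ n) (WeakNhds 𝕜 X)),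
      ‖A (∑ i ∈ Finset.range n, a i • levelSum 𝕜 ξ n (i + 1) x t)‖ₑ

/-- The vector `∑_{i=1}^n e_i` of `c₀₀`. -/
def basisSum (𝕜 : Type*) [RCLike 𝕜] (n : ℕ) : ℕ →₀ 𝕜 :=
  ∑ i ∈ Finset.range n, Finsupp.single i 1

/-- `α_{ξ,p,n}(A)`, the supremum of `‖∑_{i=1}^n a_i e_i‖_{ξ,A}` over `a ∈ B_{ℓ_p^n}`. -/
def alphaFin (ξ : Ordinal) (p : ℝ≥0∞) [Fact (1 ≤ p)] (n : ℕ) (A : X →L[𝕜] Y) : ℝ≥0∞ :=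
  ⨆ a ∈ Metric.closedBall (0 : PiLp p (fun _ : Fin n => 𝕜)) 1,
    treeNorm ξ A (∑ i : Fin n, Finsupp.single (i : ℕ) (a i))

/-- `α_{ξ,p}(A) = sup_n α_{ξ,p,n}(A)`. -/
def alpha (ξ : Ordinal) (p : ℝ≥0∞) [Fact (1 ≤ p)] (A : X →L[𝕜] Y) : ℝ≥0∞ :=
  ⨆ (n : ℕ) (_ : 1 ≤ n), alphaFin ξ p n A

/-- `θ_{ξ,n}(A) = ‖n⁻¹ ∑_{i=1}^n e_i‖_{ξ,A}`. -/
def theta (ξ : Ordinal) (n : ℕ) (A : X →L[𝕜] Y) : ℝ≥0∞ :=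
  treeNorm ξ A ((n : 𝕜)⁻¹ • basisSum 𝕜 n)

/-- The component in `𝓛(X, Y)` of the class `𝔄_{ξ,p}`: the operators with `α_{ξ,p}(A) < ∞`. -/
def classA (𝕜 : Type*) [RCLike 𝕜] (ξ : Ordinal) (p : ℝ≥0∞) [Fact (1 ≤ p)]
    (X Y : Type*) [NormedAddCommGroup X] [NormedSpace 𝕜 X]
    [NormedAddCommGroup Y] [NormedSpace 𝕜 Y] : Set (X →L[𝕜] Y) :=
  {A | alpha ξ p A < ∞}

/-- The component in `𝓛(X, Y)` of the class `𝔑_{ξ,p}`: the operators with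
`sup_n θ_{ξ,n}(A) n^{1/q} < ∞`, where `1/q = 1 - 1/p` (so that `1/q = 1` for `p = ∞`). -/
def classN (𝕜 : Type*) [RCLike 𝕜] (ξ : Ordinal) (p : ℝ≥0∞)
    (X Y : Type*) [NormedAddCommGroup X] [NormedSpace 𝕜 X]
    [NormedAddCommGroup Y] [NormedSpace 𝕜 Y] : Set (X →L[𝕜] Y) :=
  {A | (⨆ (n : ℕ) (_ : 1 ≤ n), theta ξ n A * (n : ℝ≥0∞) ^ (1 - p⁻¹).toReal) < ∞}

end AsymptoticProperties

end

namespace AsymptoticProperties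

open Ordinal

/-! Let `a` have coefficients of modulus at most 1. Replacing `x_s` by `a_i x_s` on the `i`-th level
keeps a family weakly null and in the unit ball, so evaluating the norm at `a` is the same as
evaluating it at the all-ones vector on the new family. Hence `treeNorm_le_iSup_basisSum`. Since the
all-ones vector lies in the unit ball of `ℓ_∞^n`, equality follows in `alpha_top_eq`. Homogeneity
turns `n θ_{ξ,n}` into the norm of the sum of the first `n` basis vectors, so both classes are
defined by the same supremum. The rescaling needs each sequence to lie on only one level
(`level_index_unique`); the ordinal bounds serve this. -/

theorem stack_nonempty_lt {ξ : Ordinal} {G : Set (List Ordinal)}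
    (hG : ∀ t ∈ G, t ≠ [] ∧ ∀ ζ ∈ t, ζ < ω ^ ξ) (n : ℕ) :
    ∀ t ∈ stack ξ G n, t ≠ [] ∧ ∀ ζ ∈ t, ζ < ω ^ ξ * n := by
  have key (n : ℕ) {s : List Ordinal} (hs : ∀ ζ ∈ s, ζ < ω ^ ξ) :
      ∀ ζ ∈ shift (ω ^ ξ * n) s, ζ < ω ^ ξ * (n + 1 : ℕ) := by
    intro ζ hζ
    obtain ⟨η, hη, rfl⟩ := List.mem_map.1 hζ
    rw [Nat.cast_succ, mul_add_one]
    exact add_lt_add_right (hs η hη) _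
  induction n with
  | zero => exact fun t ht => ht.elim
  | succ n ih =>
    rintro t (⟨s, hs, rfl⟩ | ⟨v, hv, u, hu, rfl⟩)
    · exact ⟨by simpa [shift] using (hG s hs).1, key n (hG s hs).2⟩
    · refine ⟨by simp [(ih u hu).1], fun ζ hζ => ?_⟩
      rcases List.mem_append.1 hζ with hζ | hζ
      · exact key n (hG v hv.1).2 ζ hζ
      · exact ((ih u hu).2 ζ hζ).trans_le (mul_le_mul_right (by simp) _)

/-- The members of `Γ_{ξ,1}` are non-empty sequences of ordinals below `ω ^ ξ`. -/
theorem gammaOne_nonempty_lt (ξ : Ordinal) :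
    ∀ t ∈ gammaOne ξ, t ≠ [] ∧ ∀ ζ ∈ t, ζ < ω ^ ξ := by
  induction ξ using Ordinal.limitRecOn with
  | zero =>
    intro t ht
    rw [gammaOne, Ordinal.limitRecOn_zero, Set.mem_singleton_iff] at ht
    simp [ht]
  | add_one ξ ih =>
    intro t ht
    rw [gammaOne, Ordinal.limitRecOn_add_one] at ht
    obtain ⟨n, -, ht⟩ := ht
    obtain ⟨h₁, h₂⟩ := stack_nonempty_lt ih n t ht
    refine ⟨h₁, fun ζ hζ => (h₂ ζ hζ).trans ?_⟩
    rw [opow_add, opow_one]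
    exact mul_lt_mul_of_pos_left (natCast_lt_omega0 n) (opow_pos _ omega0_pos)
  | limit ξ hξ ih =>
    intro t ht
    rw [gammaOne, Ordinal.limitRecOn_limit _ _ _ _ hξ] at ht
    obtain ⟨ζ, hζ, s, hs, rfl⟩ := ht
    obtain ⟨h₁, h₂⟩ := ih (ζ + 1) (hξ.add_one_lt hζ) s hs
    refine ⟨by simpa [shift] using h₁, fun η hη => ?_⟩
    obtain ⟨ρ, hρ, rfl⟩ := List.mem_map.1 hη
    exact isPrincipal_add_omega0_opow ξ ((opow_lt_opow_iff_right one_lt_omega0).2 hζ)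
      ((h₂ ρ hρ).trans ((opow_lt_opow_iff_right one_lt_omega0).2 (hξ.add_one_lt hζ)))

/-- The last entry of a member of `Λ_{ξ,n,i}` lies in `[ω ^ ξ (n - i), ω ^ ξ (n - i + 1))`. -/
theorem getLast?_of_mem_level {ξ : Ordinal} {n i : ℕ} {t : List Ordinal} (ht : t ∈ level ξ n i) :
    ∃ m : ℕ, m + i = n ∧ ∃ ζ < ω ^ ξ, t.getLast? = some (ω ^ ξ * m + ζ) := by
  induction n generalizing i t with
  | zero => simp [level] at ht
  | succ n ih =>
    match i, ht with
    | 0, ht => simp [level] at ht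
    | 1, ⟨s, hs, h⟩ =>
      obtain ⟨h₁, h₂⟩ := gammaOne_nonempty_lt ξ s hs
      exact ⟨n, rfl, s.getLast h₁, h₂ _ (List.getLast_mem h₁), by
        rw [h, shift, List.getLast?_map, List.getLast?_eq_some_getLast h₁, Option.map_some]⟩
    | i + 2, ⟨v, hv, u, hu, h⟩ =>
      obtain ⟨m, hm, ζ, hζ, hl⟩ := ih hu
      exact ⟨m, by omega, ζ, hζ, by rw [h, List.getLast?_append, hl, Option.some_or]⟩

/-- The levels of `Γ_{ξ,n}` are pairwise disjoint. -/
theorem level_index_unique {ξ : Ordinal} {n i j : ℕ} {t : List Ordinal}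
    (hi : t ∈ level ξ n i) (hj : t ∈ level ξ n j) : i = j := by
  obtain ⟨m, hm, ζ, hζ, h⟩ := getLast?_of_mem_level hi
  obtain ⟨m', hm', ζ', hζ', h'⟩ := getLast?_of_mem_level hj
  have e : ω ^ ξ * m + ζ = ω ^ ξ * m' + ζ' := Option.some_injective _ (h.symm.trans h')
  have hpos : ω ^ ξ ≠ 0 := (opow_pos _ omega0_pos).ne'
  -- The quotient of the last entry by `ω ^ ξ` is `n - i`, which determines the level.
  have e' := congrArg (· / ω ^ ξ) e
  simp only [mul_add_div _ hpos, div_eq_zero_of_lt hζ, div_eq_zero_of_lt hζ', add_zero,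
    Nat.cast_inj] at e'
  omega

variable {𝕜 : Type*} [RCLike 𝕜] {X Y : Type*} [NormedAddCommGroup X] [NormedSpace 𝕜 X]
  [NormedAddCommGroup Y] [NormedSpace 𝕜 Y]

open Classical in
/-- The scalar `a i` on the level `Λ_{ξ,n,i+1}`, and `0` off all levels. -/
noncomputable def levelCoeff (ξ : Ordinal) (n : ℕ) (a : ℕ → 𝕜) (t : List Ordinal) : 𝕜 :=
  if h : ∃ i, t ∈ level ξ n (i + 1) then a h.choose else 0

theorem levelCoeff_of_mem {ξ : Ordinal} {n i : ℕ} (a : ℕ → 𝕜) {t : List Ordinal}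
    (ht : t ∈ level ξ n (i + 1)) : levelCoeff ξ n a t = a i := by
  have h : ∃ i, t ∈ level ξ n (i + 1) := ⟨i, ht⟩
  rw [levelCoeff, dif_pos h, Nat.succ_injective (level_index_unique h.choose_spec ht)]

theorem norm_levelCoeff_le_one {ξ : Ordinal} {n : ℕ} {a : ℕ → 𝕜} (ha : ∀ i, ‖a i‖ ≤ 1)
    (t : List Ordinal) : ‖levelCoeff ξ n a t‖ ≤ 1 := by
  unfold levelCoeff
  split_ifs
  · exact ha _
  · simp

/-- Multiplying each level by a scalar of modulus at most `1` preserves `ℬ^X_{ξ,n}`. -/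
theorem levelCoeff_smul_mem_nullCollections {ξ : Ordinal} {n : ℕ} {a : ℕ → 𝕜}
    (ha : ∀ i, ‖a i‖ ≤ 1) {x : List (Ordinal × WeakNhds 𝕜 X) → X}
    (hx : x ∈ nullCollections 𝕜 X ξ n) :
    (fun t => levelCoeff ξ n a (t.map Prod.fst) • x t) ∈ nullCollections 𝕜 X ξ n := by
  refine ⟨fun t ht => ?_, fun t ht ζ hζ => ?_⟩
  · rw [norm_smul]
    exact mul_le_one₀ (norm_levelCoeff_le_one ha _) (norm_nonneg _) (hx.1 t ht)
  -- The coefficient sees only the ordinal coordinates, so it is constant along the net indexed by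
  -- `u`.
  · simpa using (hx.2 t ht ζ hζ).const_smul (levelCoeff ξ n a (t.map Prod.fst ++ [ζ]))

theorem levelSum_levelCoeff_smul {D : Type*} (ξ : Ordinal) (n i : ℕ) (a : ℕ → 𝕜)
    (x : List (Ordinal × D) → X) (t : List (Ordinal × D)) :
    levelSum 𝕜 ξ n (i + 1) (fun t => levelCoeff ξ n a (t.map Prod.fst) • x t) t =
      a i • levelSum 𝕜 ξ n (i + 1) x t := by
  classical
  simp only [levelSum, Finset.smul_sum]
  refine Finset.sum_congr rfl fun k hk => ?_
  rw [levelCoeff_of_mem a (Finset.mem_filter.1 hk).2, smul_comm]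

theorem basisSum_apply_of_lt {n i : ℕ} (h : i < n) : basisSum 𝕜 n i = 1 := by
  simp [basisSum, Finsupp.single_apply, h]

theorem treeNorm_le_iSup_basisSum (ξ : Ordinal) (A : X →L[𝕜] Y) {a : ℕ →₀ 𝕜}
    (ha : ∀ i, ‖a i‖ ≤ 1) :
    treeNorm ξ A a ≤ ⨆ (n : ℕ) (_ : 1 ≤ n), treeNorm ξ A (basisSum 𝕜 n) := by
  -- The same `n` serves as the number of basis vectors and as the number of levels of the tree, so
  -- every level carries coefficient 1 on the right.
  refine iSup₂_le fun n hn => iSup₂_le fun x hx => le_iSup₂_of_le n hn ?_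
  refine le_iSup₂_of_le n hn
    (le_iSup₂_of_le _ (levelCoeff_smul_mem_nullCollections ha hx) (le_of_eq ?_))
  refine iInf_congr fun t => iInf_congr fun _ => congrArg (fun z => ‖A z‖ₑ) ?_
  refine Finset.sum_congr rfl fun i hi => ?_
  rw [levelSum_levelCoeff_smul, basisSum_apply_of_lt (Finset.mem_range.1 hi), one_smul]

theorem alpha_top_eq (ξ : Ordinal) (A : X →L[𝕜] Y) :
    alpha ξ ∞ A = ⨆ (n : ℕ) (_ : 1 ≤ n), treeNorm ξ A (basisSum 𝕜 n) := by
  refine le_antisymm (iSup₂_le fun n _ => iSup₂_le fun a ha => ?_) (iSup₂_mono fun n _ => ?_)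
  · refine treeNorm_le_iSup_basisSum ξ A fun i => ?_
    rw [mem_closedBall_zero_iff] at ha
    by_cases hi : i < n
    · have : (∑ j : Fin n, Finsupp.single (j : ℕ) (a j)) i = a ⟨i, hi⟩ := by
        rw [Finsupp.finsetSum_apply, Finset.sum_eq_single ⟨i, hi⟩]
        · simp
        · intro j _ hj
          exact Finsupp.single_eq_of_ne fun h => hj (Fin.ext h.symm)
        · simp
      rw [this]
      exact (PiLp.norm_apply_le a _).trans ha
    · have : (∑ j : Fin n, Finsupp.single (j : ℕ) (a j)) i = 0 := by
        rw [Finsupp.finsetSum_apply]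
        exact Finset.sum_eq_zero fun j _ => Finsupp.single_eq_of_ne (by omega)
      simp [this]
  · have h : WithLp.toLp ∞ (fun _ : Fin n => (1 : 𝕜)) ∈
        Metric.closedBall (0 : PiLp ∞ (fun _ : Fin n => 𝕜)) 1 := by
      rw [mem_closedBall_zero_iff, PiLp.norm_toLp]
      exact (pi_norm_le_iff_of_nonneg zero_le_one).2 fun _ => norm_one.le
    refine le_iSup₂_of_le _ h (le_of_eq ?_)
    rw [basisSum, ← Fin.sum_univ_eq_sum_range (fun i => Finsupp.single i (1 : 𝕜))]

/-- With `c ≠ 0` the factor passes through every infimum, including those over an empty index, whose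
value is `∞`. -/
theorem treeNorm_smul (ξ : Ordinal) (A : X →L[𝕜] Y) {c : 𝕜} (hc : c ≠ 0) (a : ℕ →₀ 𝕜) :
    treeNorm ξ A (c • a) = ‖c‖ₑ * treeNorm ξ A a := by
  simp only [treeNorm, ENNReal.mul_iSup,
    ENNReal.mul_iInf_of_ne (enorm_ne_zero.2 hc) enorm_ne_top, Finsupp.smul_apply, smul_assoc,
    ← Finset.smul_sum, map_smul, enorm_smul]

theorem theta_mul_natCast (ξ : Ordinal) (A : X →L[𝕜] Y) {n : ℕ} (hn : 1 ≤ n) :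
    theta ξ n A * n = treeNorm ξ A (basisSum 𝕜 n) := by
  have h0 : (n : 𝕜) ≠ 0 := Nat.cast_ne_zero.2 (by omega)
  have h : ‖(n : 𝕜)‖ₑ = n := by
    rw [← ofReal_norm, RCLike.norm_natCast, ENNReal.ofReal_natCast]
  rw [theta, mul_comm, ← h, ← treeNorm_smul ξ A h0, smul_inv_smul₀ h0]

end AsymptoticProperties

theorem mainTheorem9 {𝕜 : Type*} [RCLike 𝕜] {X Y : Type*}
    [NormedAddCommGroup X] [NormedSpace 𝕜 X] [CompleteSpace X]
    [NormedAddCommGroup Y] [NormedSpace 𝕜 Y] [CompleteSpace Y] (ξ : Ordinal) :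
    AsymptoticProperties.classA 𝕜 ξ ∞ X Y = AsymptoticProperties.classN 𝕜 ξ ∞ X Y ∧
    ∀ A : X →L[𝕜] Y,
      AsymptoticProperties.alpha ξ ∞ A < ∞ ↔
        (⨆ (n : ℕ) (_ : 1 ≤ n),
          AsymptoticProperties.treeNorm ξ A (AsymptoticProperties.basisSum 𝕜 n)) < ∞ := by
  refine ⟨Set.ext fun A => ?_, fun A => by rw [AsymptoticProperties.alpha_top_eq]⟩
  have h : (⨆ (n : ℕ) (_ : 1 ≤ n),
      AsymptoticProperties.theta ξ n A * (n : ℝ≥0∞) ^ (1 - ∞⁻¹ : ℝ≥0∞).toReal) =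
      ⨆ (n : ℕ) (_ : 1 ≤ n),
        AsymptoticProperties.treeNorm ξ A (AsymptoticProperties.basisSum 𝕜 n) :=
    iSup_congr fun n => iSup_congr fun hn => by
      -- For `p = ∞` the exponent `1 - p⁻¹` is 1.
      simp [AsymptoticProperties.theta_mul_natCast ξ A hn]
  simp only [AsymptoticProperties.classA, AsymptoticProperties.classN, Set.mem_ofPred_eq,
    AsymptoticProperties.alpha_top_eq, h]
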